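/- Let $H$ be an infinite-dimensional separable complex Hilbert space. Consider the following three spaces: the space $\mathcal{B}(H)$ of bounded operators, with the Borel structure generated by the strong operator topology (a standard Borel space); the set $\mathcal{B}(H)_{\le 1}$ of operators of norm at most $1$, with the strong operator topology (a Polish space); and the set $\mathcal{K}(H)$ of compact operators, with the operator norm topology (a Polish space). For bounded operators $T,S$ on $H$ write - $T\equiv_f S$ if $T-S$ has finite rank, - $T\equiv_{\mathrm{ess}} S$ if $T-S$ is compact, - $T\equiv_p S$, for real $1\le p<\infty$, if $T-S$ belongs to the Schatten $p$-class, i.e. $\mathrm{tr}(|T-S|^p)<\infty$, where $|A|=(A^*A)^{1/2}$ and $\mathrm{tr}(A)=\sum_n\langle Ae_n,e_n\rangle\in[0,\infty]$ for a positive operator $A$ and an orthonormal basis $(e_n)$ of $H$ (the value does not depend on the basis). Then $\mathcal{B}(H)$ is standard Borel, $\mathcal{B}(H)_{\le1}$ and $\mathcal{K}(H)$ are Polish, and on each of these three spaces $X$ (by restriction) $\equiv_f$, $\equiv_{\mathrm{ess}}$ and, for every real $1\le p<\infty$, $\equiv_p$ are Borel equivalence relations: they are equivalence relations, and $\{(x,y)\in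 X^2 : x\equiv y\}$ is a Borel subset of $X^2$ (for $X=\mathcal{B}(H)$, with respect to the product Borel structure). Moreover, for $X=\mathcal{B}(H)_{\le1}$ and for $X=\mathcal{K}(H)$, the relation $\equiv_f$ is an $F_\sigma$ subset of $X^2$ (a countable union of closed sets), and $\equiv_{\mathrm{ess}}$ is an $F_{\sigma\delta}$ subset of $X^2$ (a countable intersection of $F_\sigma$ sets). -/

import Mathlib

open Set Topology MeasureTheory
open scoped ENNReal InnerProductSpace

namespace OperatorRelations

/-! ### Descriptive set theory -/

/-- An `F_σ` set: a countable union of closed sets. -/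
def IsFSigma {X : Type*} [TopologicalSpace X] (s : Set X) : Prop :=
  ∃ F : ℕ → Set X, (∀ n, IsClosed (F n)) ∧ s = ⋃ n, F n

/-- An `F_{σδ}` set: a countable intersection of `F_σ` sets. -/
def IsFSigmaDelta {X : Type*} [TopologicalSpace X] (s : Set X) : Prop :=
  ∃ F : ℕ → Set X, (∀ n, IsFSigma (F n)) ∧ s = ⋂ n, F n

/-- The set of pairs `{(x, y) ∈ X² : x E y}`. -/
def relGraph {X : Type*} (E : X → X → Prop) : Set (X × X) := {q | E q.1 q.2}

/-- A Borel equivalence relation: an equivalence relation whose set of pairs is measurable in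
the product Borel space `X × X`. -/
structure IsBorelEquivalence {X : Type*} [MeasurableSpace X] (E : X → X → Prop) : Prop where
  equivalence : Equivalence E
  measurableSet_relGraph : MeasurableSet (relGraph E)

section Operators

variable (H : Type*) [NormedAddCommGroup H] [InnerProductSpace ℂ H]

/-! ### The three spaces of operators -/

/-- `B(H)` with the strong operator topology, i.e. the topology of pointwise convergence. -/
abbrev StrongOp := H →Lₚₜ[ℂ] H

/-- The Borel structure generated by the strong operator topology. -/
noncomputable instance : MeasurableSpace (StrongOp H) := borel (StrongOp H)

instance : BorelSpace (StrongOp H) := ⟨rfl⟩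

variable {H} in
/-- The underlying bounded operator. -/
noncomputable def StrongOp.toCLM (T : StrongOp H) : H →L[ℂ] H :=
  (ContinuousLinearMap.toUniformConvergenceCLM (RingHom.id ℂ) H {s : Set H | Finite s}).symm T

/-- The operators of norm at most one, with the strong operator topology
and the Borel structure that it generates. -/
abbrev StrongBall := {T : StrongOp H // ‖T.toCLM‖ ≤ 1}

/-- The compact operators, with the operator norm topology
and the Borel structure that it generates. -/
abbrev CompactOp := compactOperator (RingHom.id ℂ) H H

variable {H}

/-! ### Schatten classes -/

/-- The trace `∑ ⟨T eᵢ, eᵢ⟩ ∈ [0, ∞]` of a positive operator in the orthonormal basis `e`. -/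
noncomputable def traceIn {ι : Type*} (e : HilbertBasis ι ℂ H) (T : H →L[ℂ] H) : ℝ≥0∞ :=
  ∑' i, ENNReal.ofReal (RCLike.re ⟪T (e i), e i⟫_ℂ)

variable (H) [CompleteSpace H] in
/-- An index set of some orthonormal basis of `H`. -/
noncomputable def basisIndex : Set H := (exists_hilbertBasis ℂ H).choose

variable (H) [CompleteSpace H] in
/-- Some orthonormal basis of `H`. -/
noncomputable def someBasis : HilbertBasis (basisIndex H) ℂ H :=
  (exists_hilbertBasis ℂ H).choose_spec.choose

/-- The trace of a positive operator; see `trace_eq_traceIn` for its independence of the basis. -/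
noncomputable def trace [CompleteSpace H] (T : H →L[ℂ] H) : ℝ≥0∞ := traceIn (someBasis H) T

theorem parseval {ι : Type*} (e : HilbertBasis ι ℂ H) (x : H) :
    ENNReal.ofReal (‖x‖ ^ 2) = ∑' i, ENNReal.ofReal (‖⟪e i, x⟫_ℂ‖ ^ 2) := by
  have h := e.hasSum_inner_mul_inner x x
  have h2 : HasSum (fun i => ‖⟪e i, x⟫_ℂ‖ ^ 2) (‖x‖ ^ 2) := by
    have h3 := RCLike.hasSum_re ℂ h
    rw [inner_self_eq_norm_sq] at h3
    convert h3 using 2 with i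
    rw [← inner_conj_symm x (e i), RCLike.conj_mul, ← RCLike.ofReal_pow, RCLike.ofReal_re]
  rw [← h2.tsum_eq, ENNReal.ofReal_tsum_of_nonneg (fun _ => by positivity) h2.summable]

variable [CompleteSpace H]

theorem traceIn_star_mul_self {ι κ : Type*} (e : HilbertBasis ι ℂ H) (f : HilbertBasis κ ℂ H)
    (S : H →L[ℂ] H) :
    traceIn f (star S * S) = ∑' j, ENNReal.ofReal (‖(star S) (e j)‖ ^ 2) := by
  have key : traceIn f (star S * S) =
      ∑' i, ∑' j, ENNReal.ofReal (‖⟪e j, S (f i)⟫_ℂ‖ ^ 2) := by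
    refine tsum_congr fun i => ?_
    rw [← parseval e, mul_apply_eq_comp, ContinuousLinearMap.star_eq_adjoint,
      ContinuousLinearMap.adjoint_inner_left, inner_self_eq_norm_sq]
  rw [key, ENNReal.tsum_comm]
  refine tsum_congr fun j => ?_
  rw [parseval f]
  refine tsum_congr fun i => ?_
  rw [ContinuousLinearMap.star_eq_adjoint, ContinuousLinearMap.adjoint_inner_right,
    norm_inner_symm]

/-- The trace of a positive operator may be computed in any orthonormal basis. -/
theorem trace_eq_traceIn {ι : Type*} (e : HilbertBasis ι ℂ H) {T : H →L[ℂ] H} (hT : 0 ≤ T) :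
    trace T = traceIn e T := by
  obtain ⟨S, rfl⟩ := CStarAlgebra.nonneg_iff_eq_star_mul_self.mp hT
  rw [trace, traceIn_star_mul_self e, traceIn_star_mul_self e]

/-- `T` is in the Schatten `p`-class: `tr(|T|^p) < ∞`, where `|T| = (T^* T)^{1/2}`. -/
def IsSchatten (p : ℝ) (T : H →L[ℂ] H) : Prop := trace (CFC.abs T ^ p) < ∞

end Operators

/-! ### The equivalence relations -/

section Relations

variable {H : Type*} [NormedAddCommGroup H] [InnerProductSpace ℂ H]

/-- `T - S` has finite rank. -/
def ModFinite (T S : H →L[ℂ] H) : Prop := FiniteDimensional ℂ (T - S).range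

/-- `T - S` is compact. -/
def ModCompact (T S : H →L[ℂ] H) : Prop := IsCompactOperator (T - S)

/-- `T - S` belongs to the Schatten `p`-class. -/
def ModSchatten [CompleteSpace H] (p : ℝ) (T S : H →L[ℂ] H) : Prop := IsSchatten p (T - S)

/-- The relation on `B(H)` with its strong Borel structure given by a relation on operators. -/
def onStrong (E : (H →L[ℂ] H) → (H →L[ℂ] H) → Prop) (T S : StrongOp H) : Prop :=
  E T.toCLM S.toCLM

/-- The restriction of a relation on operators to the unit ball. -/
def onBall (E : (H →L[ℂ] H) → (H →L[ℂ] H) → Prop) (T S : StrongBall H) : Prop :=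
  E T.1.toCLM S.1.toCLM

/-- The restriction of a relation on operators to the compact operators. -/
def onCompact (E : (H →L[ℂ] H) → (H →L[ℂ] H) → Prop) (T S : CompactOp H) : Prop :=
  E T.1 S.1

end Relations

end OperatorRelations

open OperatorRelations

namespace OperatorRelations

open Filter Uniformity TopologicalSpace

/-! On each of the three spaces every evaluation `T ↦ T x` is continuous. So it suffices to express
each relation through the vectors `A x`, `A = T - S`: by closed conditions for the complexity
claims, by countably many conditions for the Borel claims.

`A` has rank below `n` iff no `n` vectors have independent images, and dependence is a closed
condition. `A` is compact iff for each `k` some stage of a fixed flag of finite-dimensional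
subspaces approximates `A x` within `‖x‖ / (k + 1)`: an `F_σδ` form.

For Schatten classes the trace of `|A| ^ p` is replaced by a bound on `∑ |⟨A xᵢ, yᵢ⟩| ^ p` over
finite Bessel families (`isSchatten_iff_exists_hasSchattenBound`). The sums are continuous in the
families, which form separable spaces, so countably many of them suffice. A finite trace gives the
bound by `A = U |A|`, Cauchy–Schwarz and Jensen; conversely, the bound makes `|A|` compact, and the
trace is computed in an eigenbasis.

As for the spaces, evaluation along a dense sequence embeds each norm ball of `B(H)` as a closed
subset of `H^ℕ`, and compact operators are norm limits of finite sums of rank-one operators. -/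

theorem _root_.MeasurableEmbedding.standardBorelSpace {α β : Type*} [MeasurableSpace α]
    [MeasurableSpace β] [StandardBorelSpace β] {f : α → β} (hf : MeasurableEmbedding f) :
    StandardBorelSpace α := by
  have : StandardBorelSpace (range f) := hf.measurableSet_range.standardBorel
  obtain ⟨τ, hb, hp⟩ := this.polish
  let := τ.induced hf.equivRange
  refine ⟨this, ⟨?_⟩, hf.equivRange.toEquiv.polishSpace_induced⟩
  rw [borel_comap, ← hb.measurable_eq]
  exact hf.equivRange.measurableEmbedding.comap_eq.symm

/-! ### Polish balls and the standard Borel structure of `B(H)` -/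

section StrongBalls

variable {H : Type*} [NormedAddCommGroup H] [InnerProductSpace ℂ H]

/-- The values of an operator of norm at most `r` along a dense sequence. -/
noncomputable def evalDenseSeq (H : Type*) [NormedAddCommGroup H] [InnerProductSpace ℂ H]
    [SeparableSpace H] (T : StrongOp H) (n : ℕ) : H :=
  T (denseSeq H n)

variable [SeparableSpace H]

theorem evalDenseSeq_injective : Function.Injective (evalDenseSeq H) := by
  intro T S h
  have : (T : H → H) = S :=
    (denseRange_denseSeq H).equalizer T.toCLM.continuous S.toCLM.continuous h
  exact DFunLike.coe_injective this

theorem continuous_evalDenseSeq : Continuous (evalDenseSeq H) :=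
  continuous_pi fun _ => continuous_eval_const _

/-- A norm ball is equicontinuous, so control along a dense sequence gives control at every point.
-/
theorem isUniformInducing_evalDenseSeq (r : ℝ) :
    IsUniformInducing fun T : {T : StrongOp H // ‖T.toCLM‖ ≤ r} => evalDenseSeq H T.1 := by
  have hc : IsUniformInducing fun T : {T : StrongOp H // ‖T.toCLM‖ ≤ r} => (T.1 : H → H) :=
    (PointwiseConvergenceCLM.isUniformEmbedding_coeFn _ H H).isUniformInducing.comp
      (isUniformInducing_val _)
  refine ⟨le_antisymm ?_ ?_⟩
  · rw [← hc.comap_uniformity, Pi.uniformity (fun _ : H => H), comap_iInf]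
    refine le_iInf fun x => ?_
    rw [comap_comap, ← tendsto_iff_comap, Metric.uniformity_basis_dist.tendsto_right_iff]
    intro ε hε
    -- The triangle inequality will cost `ε / 4` at each end and less than `ε / 2` in the middle;
    -- `|r| + 1` keeps the denominator positive for every `r`.
    obtain ⟨n, hn⟩ : ∃ n, dist x (denseSeq H n) < ε / (4 * (|r| + 1)) :=
      (denseRange_denseSeq H).exists_dist_lt x (by positivity)
    have hev : ∀ᶠ q : (ℕ → H) × (ℕ → H) in 𝓤 (ℕ → H), dist (q.1 n) (q.2 n) < ε / 2 := by
      have : Tendsto (fun q : (ℕ → H) × (ℕ → H) => (q.1 n, q.2 n)) (𝓤 (ℕ → H)) (𝓤 H) :=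
        Pi.uniformContinuous_proj (fun _ : ℕ => H) n
      exact this (Metric.dist_mem_uniformity (half_pos hε))
    refine (tendsto_comap.eventually hev).mono fun q hq => ?_
    have bound : ∀ T : {T : StrongOp H // ‖T.toCLM‖ ≤ r},
        dist (T.1 x) (T.1 (denseSeq H n)) ≤ ε / 4 := by
      intro T
      have h1 : dist (T.1 x) (T.1 (denseSeq H n)) ≤
          r * dist x (denseSeq H n) := by
        rw [dist_eq_norm, dist_eq_norm]
        have := T.1.toCLM.le_of_opNorm_le T.2 (x - denseSeq H n)
        rwa [map_sub] at this
      refine h1.trans ?_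
      calc r * dist x (denseSeq H n)
          ≤ (|r| + 1) * (ε / (4 * (|r| + 1))) := by
            gcongr
            linarith [le_abs_self r]
        _ = ε / 4 := by field_simp
    have h1 := bound q.1
    have h2 := bound q.2
    have h3 := dist_triangle4 (q.1.1 x) (q.1.1 (denseSeq H n))
      (q.2.1 (denseSeq H n)) (q.2.1 x)
    rw [dist_comm (q.2.1 (denseSeq H n)) (q.2.1 x)] at h3
    change dist (q.1.1 x) (q.2.1 x) < ε
    change dist (q.1.1 (denseSeq H n)) (q.2.1 (denseSeq H n))
      < ε / 2 at hq
    linarith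
  · rw [← tendsto_iff_comap]
    exact uniformContinuous_pi.2 fun n =>
      (Pi.uniformContinuous_proj (fun _ : H => H) _).comp hc.uniformContinuous

variable [CompleteSpace H]

instance (r : ℝ) : CompleteSpace {T : StrongOp H // ‖T.toCLM‖ ≤ r} := by
  have hc : IsUniformInducing fun T : {T : StrongOp H // ‖T.toCLM‖ ≤ r} => (T.1 : H → H) :=
    (PointwiseConvergenceCLM.isUniformEmbedding_coeFn _ H H).isUniformInducing.comp
      (isUniformInducing_val _)
  rw [completeSpace_iff_isComplete_range hc]
  have : range (fun T : {T : StrongOp H // ‖T.toCLM‖ ≤ r} => (T.1 : H → H)) =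
      ((↑) : (H →L[ℂ] H) → H → H) '' Metric.closedBall 0 r := by
    ext f
    constructor
    · rintro ⟨T, rfl⟩
      exact ⟨T.1.toCLM, by simpa using T.2, rfl⟩
    · rintro ⟨T, hT, rfl⟩
      exact ⟨⟨(ContinuousLinearMap.toUniformConvergenceCLM (RingHom.id ℂ) H _ T),
        (by simpa using hT : ‖T‖ ≤ r)⟩, rfl⟩
  rw [this]
  exact (ContinuousLinearMap.isClosed_image_coe_closedBall _ r).isComplete

theorem isClosedEmbedding_evalDenseSeq (r : ℝ) :
    IsClosedEmbedding fun T : {T : StrongOp H // ‖T.toCLM‖ ≤ r} => evalDenseSeq H T.1 :=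
  ⟨⟨(isUniformInducing_evalDenseSeq r).isInducing,
    evalDenseSeq_injective.comp Subtype.val_injective⟩,
    (isUniformInducing_evalDenseSeq r).isComplete_range.isClosed⟩

theorem polishSpace_strongBall : PolishSpace (StrongBall H) :=
  (isClosedEmbedding_evalDenseSeq 1).polishSpace

/-- `B(H)` is the countable union of its balls of integer radius, so the closed embeddings of the
balls make the image of every Borel set Borel. -/
theorem standardBorelSpace_strongOp : StandardBorelSpace (StrongOp H) := by
  borelize H
  have : MeasurableEmbedding (evalDenseSeq H) := by
    refine ⟨evalDenseSeq_injective, continuous_evalDenseSeq.measurable, fun s hs => ?_⟩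
    have hU : evalDenseSeq H '' s = ⋃ N : ℕ,
        (fun T : {T : StrongOp H // ‖T.toCLM‖ ≤ (N : ℝ)} => evalDenseSeq H T.1) ''
          (Subtype.val ⁻¹' s) := by
      ext y
      simp only [mem_image, mem_iUnion, mem_preimage]
      constructor
      · rintro ⟨T, hT, rfl⟩
        obtain ⟨N, hN⟩ := exists_nat_ge ‖T.toCLM‖
        exact ⟨N, ⟨T, hN⟩, hT, rfl⟩
      · rintro ⟨N, T, hT, rfl⟩
        exact ⟨T.1, hT, rfl⟩
    rw [hU]
    exact MeasurableSet.iUnion fun N =>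
      (isClosedEmbedding_evalDenseSeq (N : ℝ)).measurableEmbedding.measurableSet_image.2
        (measurable_subtype_coe hs)
  exact this.standardBorelSpace

end StrongBalls

/-! ### Finite rank -/

section FiniteRank

variable {H : Type*} [NormedAddCommGroup H] [InnerProductSpace ℂ H]

theorem finiteDimensional_range_iff_exists_forall_not_linearIndependent (A : H →L[ℂ] H) :
    FiniteDimensional ℂ A.range ↔
      ∃ n : ℕ, ∀ x : Fin n → H, ¬ LinearIndependent ℂ fun i => A (x i) := by
  constructor
  · intro h
    refine ⟨Module.finrank ℂ A.range + 1, fun x hx => ?_⟩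
    have h1 : LinearIndependent ℂ fun i => (⟨A (x i), ⟨x i, rfl⟩⟩ : A.range) :=
      LinearIndependent.of_comp A.range.subtype hx
    simpa using h1.fintype_card_le_finrank
  · rintro ⟨n, hn⟩
    by_contra hA
    have h1 : (n : Cardinal) ≤ (A : H →ₗ[ℂ] H).rank := by
      rw [FiniteDimensional, ← Module.rank_lt_aleph0_iff, not_lt] at hA
      exact (Cardinal.natCast_le_aleph0).trans hA
    obtain ⟨s, hs, hli⟩ := LinearMap.le_rank_iff_exists_linearIndependent_finset.1 h1
    let e : Fin n ≃ s := (finCongr hs.symm).trans s.equivFin.symm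
    exact hn (fun i => (e i : H)) (hli.comp e e.injective)

theorem isFSigma_setOf_finiteDimensional_range {Y : Type*} [TopologicalSpace Y]
    {f : Y → H →L[ℂ] H} (hf : ∀ x, Continuous fun y => f y x) :
    IsFSigma {y | FiniteDimensional ℂ (f y).range} := by
  refine ⟨fun n => {y | ∀ x : Fin n → H, ¬ LinearIndependent ℂ fun i => f y (x i)},
    fun n => ?_, ?_⟩
  · simp only [ofPred_forall]
    refine isClosed_iInter fun x => IsOpen.isClosed_compl (s := {y | _}) ?_
    exact isOpen_setOfPred_linearIndependent.preimage (continuous_pi fun i => hf (x i))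
  · ext y
    simp [finiteDimensional_range_iff_exists_forall_not_linearIndependent]

theorem measurableSet_setOf_finiteDimensional_range [SeparableSpace H] {Y : Type*}
    [MeasurableSpace Y] [MeasurableSpace H] [BorelSpace H]
    {f : Y → H →L[ℂ] H} (hf : ∀ x, Measurable fun y => f y x) :
    MeasurableSet {y | FiniteDimensional ℂ (f y).range} := by
  have : {y | FiniteDimensional ℂ (f y).range} = ⋃ n : ℕ, ⋂ k : ℕ,
      {y | LinearIndependent ℂ fun i => f y (denseSeq (Fin n → H) k i)}ᶜ := by
    ext y
    simp only [finiteDimensional_range_iff_exists_forall_not_linearIndependent, mem_ofPred_eq,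
      mem_iUnion, mem_iInter, mem_compl_iff]
    refine exists_congr fun n => ⟨fun h k => h _, fun h x hx => ?_⟩
    -- For fixed `y`, independence is also open in the tuple `x`, so testing a dense sequence of
    -- tuples is enough.
    have ho : IsOpen {x : Fin n → H | LinearIndependent ℂ fun i => f y (x i)} :=
      isOpen_setOfPred_linearIndependent.preimage (by fun_prop)
    obtain ⟨k, hk⟩ := (denseRange_denseSeq (Fin n → H)).exists_mem_open ho ⟨x, hx⟩
    exact h k hk
  rw [this]
  refine MeasurableSet.iUnion fun n => MeasurableSet.iInter fun k => MeasurableSet.compl ?_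
  exact (measurable_pi_lambda _ fun i => hf _) isOpen_setOfPred_linearIndependent.measurableSet

end FiniteRank

/-! ### Compact operators -/

section Compact

variable {H : Type*} [NormedAddCommGroup H] [InnerProductSpace ℂ H]

theorem norm_sub_starProjection_le (U : Submodule ℂ H) [U.HasOrthogonalProjection] (x : H)
    {v : H} (hv : v ∈ U) : ‖x - U.starProjection x‖ ≤ ‖x - v‖ := by
  rw [U.starProjection_minimal]
  exact ciInf_le ⟨0, forall_mem_range.2 fun _ => norm_nonneg _⟩ (⟨v, hv⟩ : U)

variable [SeparableSpace H]

/-- The span of the first `n` members of a dense sequence. -/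
def denseFlag (H : Type*) [NormedAddCommGroup H] [InnerProductSpace ℂ H] [SeparableSpace H]
    (n : ℕ) : Submodule ℂ H :=
  Submodule.span ℂ (denseSeq H '' Iio n)

instance (n : ℕ) : FiniteDimensional ℂ (denseFlag H n) :=
  FiniteDimensional.span_of_finite ℂ ((finite_Iio n).image _)

/-- Finitely many balls around points of the dense sequence cover the image of the unit ball, and
the projection approximates at least as well as their centres. Conversely, `A` is a norm limit of
finite-rank operators. -/
theorem isCompactOperator_iff_forall_exists_norm_sub_starProjection_le [CompleteSpace H]
    (A : H →L[ℂ] H) : IsCompactOperator A ↔ ∀ k : ℕ, ∃ n : ℕ, ∀ x,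
      ‖A x - (denseFlag H n).starProjection (A x)‖ ≤ 1 / (k + 1 : ℝ) * ‖x‖ := by
  constructor
  · intro hA k
    have hk : (0 : ℝ) < 1 / (k + 1 : ℝ) := by positivity
    obtain ⟨t, ht⟩ :=
      (hA.isCompact_closure_image_closedBall (f := (A : H →ₗ[ℂ] H)) 1).elim_finite_subcover
      (fun j : ℕ => Metric.ball (denseSeq H j) (1 / (k + 1 : ℝ))) (fun _ => Metric.isOpen_ball)
      fun y _ => mem_iUnion.2 <| by
        simpa using (denseRange_denseSeq H).exists_dist_lt y hk
    -- The flag at `n` uses only indices below `n`, hence the successor.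
    refine ⟨t.sup id + 1, fun x => ?_⟩
    have key : ∀ x : H, ‖x‖ ≤ 1 →
        ‖A x - (denseFlag H (t.sup id + 1)).starProjection (A x)‖ ≤ 1 / (k + 1 : ℝ) := by
      intro x hx
      obtain ⟨j, hj, hjx⟩ := mem_iUnion₂.1 <| ht <| subset_closure <|
        mem_image_of_mem (A : H →ₗ[ℂ] H) (by simpa using hx : x ∈ Metric.closedBall (0 : H) 1)
      have hm : denseSeq H j ∈ denseFlag H (t.sup id + 1) :=
        Submodule.subset_span ⟨j, Nat.lt_succ_of_le (Finset.le_sup (f := id) hj), rfl⟩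
      refine (norm_sub_starProjection_le _ _ hm).trans ?_
      rw [← dist_eq_norm]
      exact (Metric.mem_ball.1 hjx).le
    have := ContinuousLinearMap.opNorm_le_of_unit_norm
      (f := (A - (denseFlag H (t.sup id + 1)).starProjection ∘L A : H →L[ℂ] H)) hk.le
      fun x hx => key x hx.le
    exact (A - (denseFlag H (t.sup id + 1)).starProjection ∘L A).le_of_opNorm_le this x
  · intro h
    have hc := isClosed_setOfPred_isCompactOperator (σ₁₂ := RingHom.id ℂ) (M₁ := H) (M₂ := H)
    refine hc.closure_subset_iff.2 subset_rfl (Metric.mem_closure_iff.2 fun ε hε => ?_)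
    obtain ⟨k, hk⟩ := exists_nat_one_div_lt hε
    obtain ⟨n, hn⟩ := h k
    refine ⟨(denseFlag H n).starProjection ∘L A, ?_, ?_⟩
    · have : IsCompactOperator ((denseFlag H n).subtypeL : denseFlag H n →L[ℂ] H) :=
        isCompactOperator_of_locallyCompactSpace_rng _
      exact this.comp_clm ((denseFlag H n).orthogonalProjectionOnto ∘L A)
    · rw [dist_eq_norm]
      exact (ContinuousLinearMap.opNorm_le_bound _ (by positivity) hn).trans_lt hk

variable [CompleteSpace H]

theorem isFSigmaDelta_setOf_isCompactOperator {Y : Type*} [TopologicalSpace Y]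
    {f : Y → H →L[ℂ] H} (hf : ∀ x, Continuous fun y => f y x) :
    IsFSigmaDelta {y | IsCompactOperator (f y)} := by
  refine ⟨fun k => {y | ∃ n : ℕ, ∀ x, ‖f y x - (denseFlag H n).starProjection (f y x)‖ ≤
    1 / (k + 1 : ℝ) * ‖x‖}, fun k => ⟨fun n => {y | ∀ x, ‖f y x -
    (denseFlag H n).starProjection (f y x)‖ ≤ 1 / (k + 1 : ℝ) * ‖x‖}, fun n => ?_, ?_⟩, ?_⟩
  · simp only [ofPred_forall]
    refine isClosed_iInter fun x => isClosed_le ?_ continuous_const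
    have := hf x
    fun_prop
  · ext y
    simp
  · ext y
    simp [isCompactOperator_iff_forall_exists_norm_sub_starProjection_le]

theorem measurableSet_setOf_isCompactOperator {Y : Type*}
    [MeasurableSpace Y] [MeasurableSpace H] [BorelSpace H]
    {f : Y → H →L[ℂ] H} (hf : ∀ x, Measurable fun y => f y x) :
    MeasurableSet {y | IsCompactOperator (f y)} := by
  have : {y | IsCompactOperator (f y)} = ⋂ k : ℕ, ⋃ n : ℕ, ⋂ j : ℕ,
      {y | ‖f y (denseSeq H j) - (denseFlag H n).starProjection (f y (denseSeq H j))‖ ≤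
        1 / (k + 1 : ℝ) * ‖denseSeq H j‖} := by
    ext y
    simp only [isCompactOperator_iff_forall_exists_norm_sub_starProjection_le, mem_ofPred_eq,
      mem_iUnion, mem_iInter]
    refine forall_congr' fun k => exists_congr fun n => ⟨fun h j => h _, fun h => ?_⟩
    have hcl : IsClosed {x : H | ‖f y x - (denseFlag H n).starProjection (f y x)‖ ≤
        1 / (k + 1 : ℝ) * ‖x‖} := isClosed_le (by fun_prop) (by fun_prop)
    intro x
    exact hcl.closure_subset_iff.2 (range_subset_iff.2 h) (denseRange_denseSeq H x)
  rw [this]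
  refine MeasurableSet.iInter fun k => MeasurableSet.iUnion fun n => MeasurableSet.iInter fun j =>
    measurableSet_le ?_ measurable_const
  have hg : Continuous fun v : H => ‖v - (denseFlag H n).starProjection v‖ := by fun_prop
  exact hg.measurable.comp (hf _)

theorem isSeparable_setOf_isCompactOperator :
    IsSeparable {A : H →L[ℂ] H | IsCompactOperator A} := by
  have hS : IsSeparable (⋃ n : ℕ, range fun q : Fin n → H × H =>
      ∑ i, InnerProductSpace.rankOne ℂ (q i).1 (q i).2) := by
    refine .iUnion fun n => isSeparable_range (continuous_finsetSum _ fun i _ => ?_)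
    have : Continuous fun q : H × H => InnerProductSpace.rankOne ℂ q.1 q.2 := by
      simp only [InnerProductSpace.rankOne_def]
      fun_prop
    exact this.comp (continuous_apply i)
  refine hS.closure.mono fun A hA => Metric.mem_closure_iff.2 fun ε hε => ?_
  obtain ⟨k, hk⟩ := exists_nat_one_div_lt hε
  obtain ⟨n, hn⟩ := (isCompactOperator_iff_forall_exists_norm_sub_starProjection_le A).1 hA k
  refine ⟨(denseFlag H n).starProjection ∘L A,
    mem_iUnion.2 ⟨Module.finrank ℂ (denseFlag H n), ?_⟩, ?_⟩
  · let b := stdOrthonormalBasis ℂ (denseFlag H n)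
    -- With `P` the projection, `P A x = ∑ ⟨b i, A x⟩ b i = ∑ ⟨A* b i, x⟩ b i`.
    refine ⟨fun i => (b i, ContinuousLinearMap.adjoint A (b i)), ?_⟩
    ext x
    simp [b.starProjection_eq_sum_rankOne, ContinuousLinearMap.adjoint_inner_left]
  · rw [dist_eq_norm]
    exact (ContinuousLinearMap.opNorm_le_bound _ (by positivity) hn).trans_lt hk

theorem polishSpace_compactOp : PolishSpace (CompactOp H) := by
  have hc : IsClosed (compactOperator (RingHom.id ℂ) H H : Set (H →L[ℂ] H)) :=
    isClosed_setOfPred_isCompactOperator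
  have : CompleteSpace (CompactOp H) := hc.completeSpace_coe
  have : SeparableSpace (CompactOp H) := isSeparable_setOf_isCompactOperator.separableSpace
  have : SecondCountableTopology (CompactOp H) := UniformSpace.secondCountable_of_separable _
  infer_instance

end Compact

/-! ### Bessel families and the Schatten bound -/

section Bessel

variable {H : Type*} [NormedAddCommGroup H] [InnerProductSpace ℂ H] {ι : Type*} [Fintype ι]

/-- A finite family satisfying Bessel's inequality. -/
def IsBesselFamily (x : ι → H) : Prop := ∀ z, ∑ i, ‖⟪x i, z⟫_ℂ‖ ^ 2 ≤ ‖z‖ ^ 2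

theorem _root_.Orthonormal.isBesselFamily {x : ι → H} (hx : Orthonormal ℂ x) :
    IsBesselFamily x := fun z => hx.sum_inner_products_le z

theorem isBesselFamily_zero : IsBesselFamily (0 : ι → H) := fun z => by simp

/-- This stability under contractions, which orthonormal families lack, is the reason for working
with Bessel families. -/
theorem IsBesselFamily.clm_apply [CompleteSpace H] {x : ι → H} (hx : IsBesselFamily x)
    {V : H →L[ℂ] H} (hV : ‖V‖ ≤ 1) : IsBesselFamily fun i => V (x i) := by
  intro z
  have h := hx (V.adjoint z)
  simp only [ContinuousLinearMap.adjoint_inner_right] at h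
  refine h.trans ?_
  have hV' : ‖V.adjoint‖ ≤ 1 := by simpa using hV
  have : ‖V.adjoint z‖ ≤ ‖z‖ := (V.adjoint.le_of_opNorm_le hV' z).trans_eq (one_mul _)
  gcongr

theorem IsBesselFamily.norm_le_one {x : ι → H} (hx : IsBesselFamily x) (i : ι) : ‖x i‖ ≤ 1 := by
  have h1 : ‖⟪x i, x i⟫_ℂ‖ ^ 2 ≤ ‖x i‖ ^ 2 :=
    (Finset.single_le_sum (f := fun j => ‖⟪x j, x i⟫_ℂ‖ ^ 2) (fun _ _ => by positivity)
      (Finset.mem_univ i)).trans (hx (x i))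
  rw [inner_self_eq_norm_sq_to_K, norm_pow, RCLike.norm_ofReal, abs_norm] at h1
  by_contra! h
  nlinarith [one_lt_pow₀ h two_ne_zero]

/-- The sums `∑ |⟨T xᵢ, yᵢ⟩|ᵖ` over finite Bessel families are bounded by `C`. -/
def HasSchattenBound (p C : ℝ) (T : H →L[ℂ] H) : Prop :=
  ∀ (n : ℕ) (x y : Fin n → H), IsBesselFamily x → IsBesselFamily y →
    ∑ i, ‖⟪T (x i), y i⟫_ℂ‖ ^ p ≤ C

theorem HasSchattenBound.sum_le {p C : ℝ} {T : H →L[ℂ] H} (hT : HasSchattenBound p C T)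
    {x y : ι → H} (hx : IsBesselFamily x) (hy : IsBesselFamily y) :
    ∑ i, ‖⟪T (x i), y i⟫_ℂ‖ ^ p ≤ C := by
  let e := Fintype.equivFin ι
  have h := hT _ (x ∘ e.symm) (y ∘ e.symm) (fun z => ?_) (fun z => ?_)
  · simpa [Equiv.sum_comp e.symm fun i => ‖⟪T (x i), y i⟫_ℂ‖ ^ p] using h
  · simpa [Equiv.sum_comp e.symm fun i => ‖⟪x i, z⟫_ℂ‖ ^ 2] using hx z
  · simpa [Equiv.sum_comp e.symm fun i => ‖⟪y i, z⟫_ℂ‖ ^ 2] using hy z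

theorem HasSchattenBound.mono {p C D : ℝ} {T : H →L[ℂ] H} (hT : HasSchattenBound p C T)
    (h : C ≤ D) : HasSchattenBound p D T := fun n x y hx hy => (hT n x y hx hy).trans h

theorem hasSchattenBound_zero {p : ℝ} (hp : p ≠ 0) : HasSchattenBound p 0 (0 : H →L[ℂ] H) := by
  intro n x y _ _
  simp [Real.zero_rpow hp]

theorem HasSchattenBound.neg {p C : ℝ} {T : H →L[ℂ] H} (hT : HasSchattenBound p C T) :
    HasSchattenBound p C (-T) := by
  intro n x y hx hy
  simpa using hT n x y hx hy

/-- A crude substitute for Minkowski's inequality: only the finiteness of the bounds matters. -/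
theorem _root_.Real.add_rpow_le_two_rpow_mul {a b p : ℝ} (ha : 0 ≤ a) (hb : 0 ≤ b) (hp : 0 ≤ p) :
    (a + b) ^ p ≤ 2 ^ p * (a ^ p + b ^ p) := by
  have ha' := Real.rpow_nonneg ha p
  have hb' := Real.rpow_nonneg hb p
  calc (a + b) ^ p ≤ (2 * max a b) ^ p := by
        gcongr
        linarith [le_max_left a b, le_max_right a b]
    _ = 2 ^ p * max a b ^ p := Real.mul_rpow (by norm_num) (le_max_of_le_left ha)
    _ ≤ 2 ^ p * (a ^ p + b ^ p) := by
        gcongr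
        rcases max_cases a b with h | h <;> rw [h.1] <;> linarith

theorem HasSchattenBound.add {p C D : ℝ} (hp : 0 ≤ p) {T S : H →L[ℂ] H}
    (hT : HasSchattenBound p C T) (hS : HasSchattenBound p D S) :
    HasSchattenBound p (2 ^ p * (C + D)) (T + S) := by
  intro n x y hx hy
  calc ∑ i, ‖⟪(T + S) (x i), y i⟫_ℂ‖ ^ p
      ≤ ∑ i, 2 ^ p * (‖⟪T (x i), y i⟫_ℂ‖ ^ p + ‖⟪S (x i), y i⟫_ℂ‖ ^ p) := by
        refine Finset.sum_le_sum fun i _ => ?_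
        refine le_trans ?_ (Real.add_rpow_le_two_rpow_mul (norm_nonneg _) (norm_nonneg _) hp)
        rw [add_apply, inner_add_left]
        gcongr
        exact norm_add_le _ _
    _ = 2 ^ p * (∑ i, ‖⟪T (x i), y i⟫_ℂ‖ ^ p + ∑ i, ‖⟪S (x i), y i⟫_ℂ‖ ^ p) := by
        rw [← Finset.mul_sum, Finset.sum_add_distrib]
    _ ≤ 2 ^ p * (C + D) := by
        gcongr
        exacts [hT n x y hx hy, hS n x y hx hy]

theorem HasSchattenBound.comp_left [CompleteSpace H] {p C : ℝ} {T U : H →L[ℂ] H}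
    (hT : HasSchattenBound p C T) (hU : ‖U‖ ≤ 1) : HasSchattenBound p C (U ∘L T) := by
  intro n x y hx hy
  have := hT n x _ hx (hy.clm_apply (V := U.adjoint) (by simpa using hU))
  simpa [ContinuousLinearMap.adjoint_inner_right] using this

variable (H) in
/-- Pairs of Bessel families of `n` vectors. -/
abbrev BesselPair (n : ℕ) :=
  {q : (Fin n → H) × (Fin n → H) // IsBesselFamily q.1 ∧ IsBesselFamily q.2}

instance (n : ℕ) : Nonempty (BesselPair H n) :=
  ⟨⟨(0, 0), isBesselFamily_zero, isBesselFamily_zero⟩⟩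

instance [SeparableSpace H] (n : ℕ) : SeparableSpace (BesselPair H n) :=
  have : SecondCountableTopology H := UniformSpace.secondCountable_of_separable H
  inferInstance

/-- The sum `∑ |⟨T xᵢ, yᵢ⟩|ᵖ`. -/
noncomputable def besselSum (p : ℝ) (T : H →L[ℂ] H) {n : ℕ} (q : BesselPair H n) : ℝ :=
  ∑ i, ‖⟪T (q.1.1 i), q.1.2 i⟫_ℂ‖ ^ p

theorem continuous_besselSum {p : ℝ} (hp : 0 ≤ p) (T : H →L[ℂ] H) (n : ℕ) :
    Continuous fun q : BesselPair H n => besselSum p T q :=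
  continuous_finsetSum _ fun i _ => (Continuous.norm (by fun_prop)).rpow_const fun _ => Or.inr hp

theorem hasSchattenBound_iff_denseSeq [SeparableSpace H] {p C : ℝ} (hp : 0 ≤ p)
    (T : H →L[ℂ] H) : HasSchattenBound p C T ↔
      ∀ n k : ℕ, besselSum p T (denseSeq (BesselPair H n) k) ≤ C := by
  constructor
  · intro h n k
    exact h n _ _ (denseSeq (BesselPair H n) k).2.1 (denseSeq (BesselPair H n) k).2.2
  · intro h n x y hx hy
    have key (q : BesselPair H n) : besselSum p T q ≤ C :=
      (denseRange_denseSeq (BesselPair H n)).induction_on q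
        (isClosed_le (continuous_besselSum hp T n) continuous_const) (h n)
    have h1 := key ⟨(x, y), hx, hy⟩
    rwa [besselSum] at h1

theorem measurableSet_setOf_exists_hasSchattenBound [SeparableSpace H] {Y : Type*}
    [MeasurableSpace Y] [MeasurableSpace H] [BorelSpace H]
    {f : Y → H →L[ℂ] H} (hf : ∀ x, Measurable fun y => f y x) {p : ℝ} (hp : 0 ≤ p) :
    MeasurableSet {y | ∃ C, HasSchattenBound p C (f y)} := by
  have : {y | ∃ C, HasSchattenBound p C (f y)} = ⋃ C : ℕ, ⋂ n : ℕ, ⋂ k : ℕ,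
      {y | besselSum p (f y) (denseSeq (BesselPair H n) k) ≤ (C : ℝ)} := by
    ext y
    simp only [mem_ofPred_eq, mem_iUnion, mem_iInter, ← hasSchattenBound_iff_denseSeq hp]
    constructor
    · rintro ⟨C, hC⟩
      obtain ⟨N, hN⟩ := exists_nat_ge C
      exact ⟨N, hC.mono hN⟩
    · rintro ⟨C, hC⟩
      exact ⟨C, hC⟩
  rw [this]
  refine MeasurableSet.iUnion fun C => MeasurableSet.iInter fun n => MeasurableSet.iInter fun k =>
    measurableSet_le (Finset.measurable_sum _ fun i _ => ?_) measurable_const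
  have hg (w : H) : Continuous fun v : H => ‖⟪v, w⟫_ℂ‖ ^ p :=
    (Continuous.norm (by fun_prop)).rpow_const fun _ => Or.inr hp
  exact (hg _).measurable.comp (hf _)

end Bessel

/-! ### Positive operators: from finite trace to the Schatten bound -/

section Positive

theorem re_inner_real_smul_left {H : Type*} [NormedAddCommGroup H] [InnerProductSpace ℂ H]
    (r : ℝ) (v z : H) : RCLike.re ⟪r • v, z⟫_ℂ = r * RCLike.re ⟪v, z⟫_ℂ := by
  rw [RCLike.real_smul_eq_coe_smul (K := ℂ), inner_smul_left, RCLike.conj_ofReal,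
    RCLike.re_ofReal_mul]

theorem re_inner_nonneg {H : Type*} [NormedAddCommGroup H] [InnerProductSpace ℂ H]
    {A : H →L[ℂ] H} (hA : 0 ≤ A) (x : H) : 0 ≤ RCLike.re ⟪A x, x⟫_ℂ :=
  ((ContinuousLinearMap.nonneg_iff_isPositive A).1 hA).re_inner_nonneg_left x

variable {H : Type*} [NormedAddCommGroup H] [InnerProductSpace ℂ H] [CompleteSpace H]

/-- **Douglas factorization** by a contraction. -/
theorem exists_contraction_comp_eq {F G : H →L[ℂ] H} (h : ∀ x, ‖F x‖ ≤ ‖G x‖) :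
    ∃ U : H →L[ℂ] H, ‖U‖ ≤ 1 ∧ F = U ∘L G := by
  let K := G.range.topologicalClosure
  have : CompleteSpace K := G.range.isClosed_topologicalClosure.completeSpace_coe
  let e : H →ₗ[ℂ] K := (G : H →ₗ[ℂ] H).codRestrict K
    fun x => G.range.le_topologicalClosure ⟨x, rfl⟩
  have hd : DenseRange e := by
    intro y
    rw [closure_subtype, ← range_comp]
    exact y.2
  have hn : ∀ x, ‖(F : H →ₗ[ℂ] H) x‖ ≤ 1 * ‖e x‖ := fun x => by
    rw [one_mul]
    exact h x
  -- The contraction `G x ↦ F x` extends to the closure `K` of the range of `G`, and is set to zero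
  -- on `Kᗮ`.
  refine ⟨(F : H →ₗ[ℂ] H).extendOfNorm e ∘L K.orthogonalProjectionOnto, ?_, ?_⟩
  · refine (ContinuousLinearMap.opNorm_comp_le _ _).trans ?_
    exact mul_le_one₀ (LinearMap.opNorm_extendOfNorm_le hd zero_le_one hn) (norm_nonneg _)
      K.orthogonalProjectionOnto_norm_le
  · ext x
    have : K.orthogonalProjectionOnto (G x) = e x :=
      K.orthogonalProjectionOnto_mem_subspace_eq_self (e x)
    simp only [ContinuousLinearMap.comp_apply, this]
    exact (LinearMap.extendOfNorm_eq hd ⟨1, hn⟩ x).symm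

theorem re_inner_star_mul_self (S : H →L[ℂ] H) (x : H) :
    RCLike.re ⟪(star S * S) x, x⟫_ℂ = ‖S x‖ ^ 2 := by
  rw [mul_apply_eq_comp, ContinuousLinearMap.star_eq_adjoint,
    ContinuousLinearMap.adjoint_inner_left, inner_self_eq_norm_sq]

theorem norm_cfcAbs_apply (T : H →L[ℂ] H) (x : H) : ‖CFC.abs T x‖ = ‖T x‖ := by
  have h1 : IsSelfAdjoint (CFC.abs T) := .of_nonneg (CFC.abs_nonneg T)
  have h2 : star (CFC.abs T) * CFC.abs T = star T * T := by rw [h1.star_eq, CFC.abs_mul_abs]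
  exact (sq_eq_sq₀ (norm_nonneg _) (norm_nonneg _)).1
    (by rw [← re_inner_star_mul_self, ← re_inner_star_mul_self, h2])

/-- Write `B = S* S`, expand `‖S xᵢ‖ ^ 2` in the basis, exchange the sums, and apply the Bessel
inequality to each `S* eⱼ`. -/
theorem sum_re_inner_le_trace {ι : Type*} [Fintype ι] {x : ι → H} (hx : IsBesselFamily x)
    {B : H →L[ℂ] H} (hB : 0 ≤ B) :
    ENNReal.ofReal (∑ i, RCLike.re ⟪B (x i), x i⟫_ℂ) ≤ trace B := by
  obtain ⟨S, rfl⟩ := CStarAlgebra.nonneg_iff_eq_star_mul_self.mp hB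
  rw [trace, traceIn_star_mul_self (someBasis H),
    ENNReal.ofReal_sum_of_nonneg fun i _ => re_inner_nonneg hB _]
  calc ∑ i, ENNReal.ofReal (RCLike.re ⟪(star S * S) (x i), x i⟫_ℂ)
      = ∑ i, ∑' j, ENNReal.ofReal (‖⟪x i, star S (someBasis H j)⟫_ℂ‖ ^ 2) := by
        refine Finset.sum_congr rfl fun i _ => ?_
        rw [re_inner_star_mul_self, parseval (someBasis H)]
        refine tsum_congr fun j => ?_
        rw [ContinuousLinearMap.star_eq_adjoint, ContinuousLinearMap.adjoint_inner_right,
          norm_inner_symm]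
    _ = ∑' j, ∑ i, ENNReal.ofReal (‖⟪x i, star S (someBasis H j)⟫_ℂ‖ ^ 2) :=
        (Summable.tsum_finsetSum fun _ _ => ENNReal.summable).symm
    _ ≤ _ := by
        refine ENNReal.tsum_le_tsum fun j => ?_
        rw [← ENNReal.ofReal_sum_of_nonneg fun i _ => by positivity]
        exact ENNReal.ofReal_le_ofReal (hx _)

/-- **Jensen's inequality** for the quadratic form of a positive operator. -/
theorem re_inner_rpow_le {A : H →L[ℂ] H} (hA : 0 ≤ A) {p : ℝ} (hp : 1 ≤ p) {z : H}
    (hz : ‖z‖ ≤ 1) : RCLike.re ⟪A z, z⟫_ℂ ^ p ≤ RCLike.re ⟪(A ^ p) z, z⟫_ℂ := by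
  have hAp : 0 ≤ A ^ p := CFC.rpow_nonneg
  set c := RCLike.re ⟪A z, z⟫_ℂ with hc
  rcases (re_inner_nonneg hA z).eq_or_lt with h0 | h0
  · rw [← hc] at h0
    rw [← h0, Real.zero_rpow (by linarith)]
    exact re_inner_nonneg hAp z
  rw [← hc] at h0
  have hsa : IsSelfAdjoint A := .of_nonneg hA
  -- The left side is the tangent to `t ^ p` at `t = c`, applied to `A`; convexity is Bernoulli's
  -- inequality at `t / c - 1`.
  have hle : algebraMap ℝ (H →L[ℂ] H) (c ^ p * (1 - p)) + (p * c ^ (p - 1)) • A ≤ A ^ p := by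
    rw [CFC.rpow_eq_cfc_real hA, ← cfc_const_mul_id (p * c ^ (p - 1)) A hsa,
      ← cfc_const_add (c ^ p * (1 - p)) _ A (by fun_prop) hsa]
    refine cfc_mono (fun t ht => ?_) (by fun_prop)
      (continuousOn_id.rpow_const fun _ _ => Or.inr (by linarith))
    have ht0 : 0 ≤ t := spectrum_nonneg_of_nonneg hA ht
    have hb := one_add_mul_self_le_rpow_one_add (s := t / c - 1)
      (by linarith [div_nonneg ht0 h0.le]) hp
    rw [add_sub_cancel, Real.div_rpow ht0 h0.le, le_div_iff₀ (by positivity)] at hb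
    refine le_trans (le_of_eq ?_) hb
    rw [Real.rpow_sub_one h0.ne']
    field_simp
    ring
  have h1 := re_inner_nonneg (sub_nonneg.2 hle) z
  have h2 : RCLike.re ⟪(algebraMap ℝ (H →L[ℂ] H) (c ^ p * (1 - p)) +
      (p * c ^ (p - 1)) • A) z, z⟫_ℂ = c ^ p * (1 - p) * ‖z‖ ^ 2 + p * c ^ (p - 1) * c := by
    rw [Algebra.algebraMap_eq_smul_one]
    simp only [add_apply, smul_apply,
      one_apply_eq_self, inner_add_left, map_add, re_inner_real_smul_left, inner_self_eq_norm_sq, ← hc]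
  rw [sub_apply, inner_sub_left, map_sub, h2] at h1
  have h3 : p * c ^ (p - 1) * c = p * c ^ p := by
    rw [Real.rpow_sub_one h0.ne']
    field_simp
  have h4 : ‖z‖ ^ 2 ≤ 1 := by nlinarith [norm_nonneg z]
  -- The constant term of the tangent is nonpositive, so `‖z‖ ≤ 1` suffices in place of `‖z‖ = 1`.
  have h5 : 0 ≤ c ^ p * (p - 1) * (1 - ‖z‖ ^ 2) :=
    mul_nonneg (mul_nonneg (by positivity) (by linarith)) (by linarith)
  nlinarith

/-- For `A = |T| = R* R`, Cauchy–Schwarz bounds `|⟨A x, y⟩|` by the larger of `⟨A x, x⟩` and `⟨A y,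
y⟩`. Jensen bounds each diagonal sum by the trace, and the contraction in `T = U A` preserves the
bound. -/
theorem IsSchatten.exists_hasSchattenBound {p : ℝ} (hp : 1 ≤ p) {T : H →L[ℂ] H}
    (hT : IsSchatten p T) : ∃ C, HasSchattenBound p C T := by
  set A := CFC.abs T with hA
  have hA0 : 0 ≤ A := CFC.abs_nonneg T
  obtain ⟨U, hU, hTU⟩ := exists_contraction_comp_eq (F := T) (G := A)
    fun x => (norm_cfcAbs_apply T x).ge
  obtain ⟨R, hR⟩ := CStarAlgebra.nonneg_iff_eq_star_mul_self.mp hA0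
  have hAp : 0 ≤ A ^ p := CFC.rpow_nonneg
  have key : ∀ (n : ℕ) (x : Fin n → H), IsBesselFamily x →
      ∑ i, RCLike.re ⟪A (x i), x i⟫_ℂ ^ p ≤ (trace (A ^ p)).toReal := fun n x hx =>
    (Finset.sum_le_sum fun i _ => re_inner_rpow_le hA0 hp (hx.norm_le_one i)).trans <|
      (ENNReal.ofReal_le_iff_le_toReal hT.ne).1 (sum_re_inner_le_trace hx hAp)
  have hAC : HasSchattenBound p ((trace (A ^ p)).toReal + (trace (A ^ p)).toReal) A := by
    intro n x y hx hy
    refine le_trans ?_ (add_le_add (key n x hx) (key n y hy))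
    rw [← Finset.sum_add_distrib]
    refine Finset.sum_le_sum fun i _ => ?_
    have h1 : ‖⟪A (x i), y i⟫_ℂ‖ ≤ ‖R (x i)‖ * ‖R (y i)‖ := by
      rw [hR, mul_apply_eq_comp, ContinuousLinearMap.star_eq_adjoint,
        ContinuousLinearMap.adjoint_inner_left]
      exact norm_inner_le_norm _ _
    have h2 : ‖R (x i)‖ * ‖R (y i)‖ ≤ max (‖R (x i)‖ ^ 2) (‖R (y i)‖ ^ 2) := by
      rcases le_total ‖R (x i)‖ ‖R (y i)‖ with h | h
      · exact le_max_of_le_right (by rw [sq]; gcongr)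
      · exact le_max_of_le_left (by rw [sq]; gcongr)
    rw [hR, re_inner_star_mul_self, re_inner_star_mul_self, ← hR]
    refine (Real.rpow_le_rpow (norm_nonneg _) (h1.trans h2) (by linarith)).trans ?_
    have ha := Real.rpow_nonneg (sq_nonneg ‖R (x i)‖) p
    have hb := Real.rpow_nonneg (sq_nonneg ‖R (y i)‖) p
    rcases max_cases (‖R (x i)‖ ^ 2) (‖R (y i)‖ ^ 2) with h | h <;> rw [h.1] <;> linarith
  exact ⟨_, hTU ▸ hAC.comp_left hU⟩

end Positive

/-! ### Eigenvectors: functional calculus and the spectral theorem -/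

section Spectral

universe u

variable {H : Type u} [NormedAddCommGroup H] [InnerProductSpace ℂ H] [CompleteSpace H]

/-- The identity holds for constants and the coordinate function, and survives sums, products and
uniform limits. -/
theorem cfc_apply_eigenvector {A : H →L[ℂ] H} (hA : IsSelfAdjoint A) {t : ℝ} {v : H}
    (hv : v ≠ 0) (hAv : A v = t • v) {f : ℝ → ℝ} (hf : ContinuousOn f (spectrum ℝ A)) :
    cfc f A v = f t • v := by
  have ht : t ∈ spectrum ℝ A := by
    rintro ⟨u, hu⟩
    have h0 : (u : H →L[ℂ] H) v = 0 := by
      rw [hu, Algebra.algebraMap_eq_smul_one]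
      simp [hAv]
    have h1 : ((↑u⁻¹ * ↑u : H →L[ℂ] H)) v = 0 := by rw [mul_apply_eq_comp, h0, map_zero]
    exact hv (by simpa using h1)
  have key (g : C(spectrum ℝ A, ℝ)) : cfcHom hA g v = g ⟨t, ht⟩ • v := by
    induction g using ContinuousMap.induction_on_of_compact with
    | const r =>
      have : ContinuousMap.const (spectrum ℝ A) r = algebraMap ℝ C(spectrum ℝ A, ℝ) r := rfl
      rw [this, AlgHomClass.commutes, Algebra.algebraMap_eq_smul_one]
      simp
    | id =>
      rw [cfcHom_id, hAv]
      rfl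
    | star_id =>
      rw [map_star, cfcHom_id, hA.star_eq, hAv]
      rfl
    | add g h hg hh => simp [hg, hh, add_smul]
    | mul g h hg hh =>
      rw [map_mul, mul_apply_eq_comp, hh, ContinuousLinearMap.map_smul_of_tower, hg, smul_smul,
        mul_comm]
      rfl
    | frequently g hg =>
      have hcl : IsClosed {g : C(spectrum ℝ A, ℝ) | cfcHom hA g v = g ⟨t, ht⟩ • v} := by
        have h1 : Continuous fun g : C(spectrum ℝ A, ℝ) => cfcHom hA g :=
          (cfcHom_isClosedEmbedding hA).continuous
        exact isClosed_eq (by fun_prop) (by fun_prop)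
      exact hcl.closure_subset (mem_closure_iff_frequently.2 hg)
  rw [cfc_apply f A]
  exact key _

open scoped ComplexOrder in
-- Hilbert bases of all the eigenspaces, the kernel included, are put together; compactness makes
-- the sum of the eigenspaces dense.
theorem exists_hilbertBasis_eigenvectors {A : H →L[ℂ] H} (hA : 0 ≤ A)
    (hc : IsCompactOperator A) : ∃ (ι : Type u) (b : HilbertBasis ι ℂ H) (l : ι → ℝ),
      ∀ i, 0 ≤ l i ∧ A (b i) = l i • b i := by
  have hpos := (ContinuousLinearMap.nonneg_iff_isPositive A).1 hA
  have hs : (A : H →ₗ[ℂ] H).IsSymmetric := hpos.isSymmetric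
  let E (μ : ℂ) := Module.End.eigenspace (A : Module.End ℂ H) μ
  have hcE (μ : ℂ) : CompleteSpace (E μ) := by
    have : IsClosed (E μ : Set H) := by
      have h1 : (E μ : Set H) = {v | A v = μ • v} := by
        ext v
        exact Module.End.mem_eigenspace_iff
      rw [h1]
      exact isClosed_eq (by fun_prop) (by fun_prop)
    exact this.completeSpace_coe
  choose w b _ using fun μ : ℂ => exists_hilbertBasis ℂ (E μ)
  have hon : Orthonormal ℂ fun a : Σ μ, w μ => (b a.1 a.2 : H) :=
    hs.orthogonalFamily_eigenspaces.orthonormal_sigma_orthonormal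
      (v_family := fun μ => (b μ : w μ → E μ)) fun μ => (b μ).orthonormal
  have hbot : (Submodule.span ℂ (range fun a : Σ μ, w μ => (b a.1 a.2 : H)))ᗮ = ⊥ := by
    rw [eq_bot_iff, ← ContinuousLinearMap.orthogonalComplement_iSup_eigenspaces_eq_bot hc hs,
      ← Submodule.iInf_orthogonal]
    refine le_iInf fun μ u hu => (Submodule.mem_orthogonal' _ _).2 fun v hv => ?_
    have h1 : Submodule.span ℂ (range (b μ)) ≤
        LinearMap.ker ((innerSL ℂ u ∘L (E μ).subtypeL : E μ →L[ℂ] ℂ) : E μ →ₗ[ℂ] ℂ) := by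
      rw [Submodule.span_le]
      rintro _ ⟨i, rfl⟩
      have := (Submodule.mem_orthogonal _ _).1 hu _ (Submodule.subset_span ⟨⟨μ, i⟩, rfl⟩)
      simpa using inner_eq_zero_symm.1 this
    have h2 := Submodule.topologicalClosure_minimal _ h1
      (ContinuousLinearMap.isClosed_ker (innerSL ℂ u ∘L (E μ).subtypeL))
    rw [(b μ).dense_span] at h2
    simpa using h2 (Submodule.mem_top (x := ⟨v, hv⟩))
  have hev (a : Σ μ, w μ) : A (b a.1 a.2 : H) = a.1 • (b a.1 a.2 : H) :=
    Module.End.mem_eigenspace_iff.1 (b a.1 a.2).2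
  have hl (a : Σ μ, w μ) : 0 ≤ a.1 := by
    have h1 := hpos.inner_nonneg_right (b a.1 a.2 : H)
    rw [hev, inner_smul_right, inner_self_eq_norm_sq_to_K] at h1
    have h2 : ‖(b a.1 a.2 : H)‖ = 1 := (b a.1).orthonormal.1 a.2
    simpa [h2] using h1
  refine ⟨Σ μ, w μ, HilbertBasis.mkOfOrthogonalEqBot hon hbot, fun a => a.1.re, fun a =>
    ⟨(Complex.le_def.1 (hl a)).1, ?_⟩⟩
  rw [HilbertBasis.coe_mkOfOrthogonalEqBot]
  have h3 : ((a.1.re : ℝ) : ℂ) = a.1 := (Complex.eq_re_of_ofReal_le (hl a)).symm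
  refine (hev a).trans ?_
  rw [← Complex.coe_smul, h3]

end Spectral

/-! ### From the Schatten bound to finite trace -/

section SchattenConverse

variable {H : Type*} [NormedAddCommGroup H] [InnerProductSpace ℂ H]

theorem HasSchattenBound.nat_mul_rpow_le {p C ε : ℝ} (hp : 0 ≤ p) (hε : 0 ≤ ε) {A : H →L[ℂ] H}
    (h : HasSchattenBound p C A) {n : ℕ} {x : Fin n → H} (hx : Orthonormal ℂ x)
    (hxε : ∀ i, ε ≤ RCLike.re ⟪A (x i), x i⟫_ℂ) : n * ε ^ p ≤ C := by
  refine le_trans ?_ (h n x x hx.isBesselFamily hx.isBesselFamily)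
  calc (n : ℝ) * ε ^ p = ∑ _i : Fin n, ε ^ p := by simp
    _ ≤ _ := Finset.sum_le_sum fun i _ =>
      Real.rpow_le_rpow hε ((hxε i).trans (RCLike.re_le_norm _)) hp

/-- An orthonormal family on which the form is at least `ε` has at most `C / ε ^ p` members. `F` is
the span of one that cannot be enlarged: a vector of `Fᗮ` violating the estimate would, once
normalised, extend it. -/
theorem HasSchattenBound.exists_finiteDimensional {p C ε : ℝ} (hp : 0 ≤ p) (hε : 0 < ε)
    {A : H →L[ℂ] H} (h : HasSchattenBound p C A) :
    ∃ F : Submodule ℂ H, FiniteDimensional ℂ F ∧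
      ∀ z ∈ Fᗮ, RCLike.re ⟪A z, z⟫_ℂ ≤ ε * ‖z‖ ^ 2 := by
  let P (n : ℕ) : Prop := ∃ x : Fin n → H, Orthonormal ℂ x ∧
    ∀ i, ε ≤ RCLike.re ⟪A (x i), x i⟫_ℂ
  have hεp : 0 < ε ^ p := Real.rpow_pos_of_pos hε p
  obtain ⟨N, hN⟩ := exists_nat_gt (C / ε ^ p)
  have hPN : ¬ P N := by
    rintro ⟨x, hx, hxε⟩
    have := h.nat_mul_rpow_le hp hε.le hx hxε
    rw [div_lt_iff₀ hεp] at hN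
    linarith
  have hP0 : P 0 := ⟨Fin.elim0, ⟨fun i => i.elim0, fun i => i.elim0⟩, fun i => i.elim0⟩
  obtain ⟨n, ⟨x, hx, hxε⟩, hn⟩ : ∃ n, P n ∧ ¬ P (n + 1) := by
    by_contra! hcon
    exact hPN (Nat.rec hP0 hcon N)
  refine ⟨Submodule.span ℂ (range x), FiniteDimensional.span_of_finite ℂ (finite_range x),
    fun z hz => ?_⟩
  by_contra! hlt
  have hz0 : z ≠ 0 := by
    rintro rfl
    simp at hlt
  have hz1 : 0 < ‖z‖ := norm_pos_iff.2 hz0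
  refine hn ⟨Matrix.vecCons (‖z‖⁻¹ • z) x, orthonormal_vecCons_iff.2 ⟨?_, fun i => ?_, hx⟩, ?_⟩
  · rw [norm_smul, norm_inv, norm_norm, inv_mul_cancel₀ hz1.ne']
  · have := (Submodule.mem_orthogonal' _ _).1 hz (x i) (Submodule.subset_span ⟨i, rfl⟩)
    rw [← Complex.coe_smul, inner_smul_left, this, mul_zero]
  · refine Fin.cases ?_ fun i => hxε i
    simp only [Matrix.cons_val_zero]
    have h1 : RCLike.re ⟪A (‖z‖⁻¹ • z), ‖z‖⁻¹ • z⟫_ℂ = ‖z‖⁻¹ ^ 2 * RCLike.re ⟪A z, z⟫_ℂ := by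
      rw [← Complex.coe_smul, map_smul, inner_smul_left, inner_smul_right, Complex.conj_ofReal,
        ← mul_assoc, ← Complex.ofReal_mul]
      exact (Complex.re_ofReal_mul _ _).trans (by rw [sq]; rfl)
    rw [h1, inv_pow, le_inv_mul_iff₀ (by positivity), mul_comm]
    exact hlt.le

variable [CompleteSpace H]

theorem HasSchattenBound.isCompactOperator {p C : ℝ} (hp : 0 ≤ p) {A : H →L[ℂ] H} (hA : 0 ≤ A)
    (h : HasSchattenBound p C A) : IsCompactOperator A := by
  obtain ⟨R, hR⟩ := CStarAlgebra.nonneg_iff_eq_star_mul_self.mp hA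
  suffices hRc : IsCompactOperator R by
    rw [hR]
    exact hRc.clm_comp (star R)
  have hc := isClosed_setOfPred_isCompactOperator (σ₁₂ := RingHom.id ℂ) (M₁ := H) (M₂ := H)
  refine hc.closure_subset_iff.2 subset_rfl (Metric.mem_closure_iff.2 fun ε hε => ?_)
  -- The form of `A` is `‖R z‖ ^ 2`, hence the square: `R` is bounded by `ε / 2` on `Fᗮ`.
  obtain ⟨F, hF, hFz⟩ := h.exists_finiteDimensional (ε := (ε / 2) ^ 2) hp (by positivity)
  refine ⟨R ∘L F.starProjection, ?_, ?_⟩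
  · have : IsCompactOperator (R ∘L F.subtypeL : F →L[ℂ] H) :=
      isCompactOperator_of_locallyCompactSpace_rng _
    exact this.comp_clm F.orthogonalProjectionOnto
  · rw [dist_eq_norm]
    refine (ContinuousLinearMap.opNorm_le_bound _ (half_pos hε).le fun x => ?_).trans_lt
      (half_lt_self hε)
    have h1 : (R - R ∘L F.starProjection) x = R (x - F.starProjection x) := by simp
    have h2 := hFz _ (F.sub_starProjection_mem_orthogonal x)
    rw [hR, re_inner_star_mul_self, ← mul_pow] at h2
    rw [h1]
    refine (abs_le_of_sq_le_sq' h2 (by positivity)).2.trans ?_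
    gcongr
    simpa using norm_sub_starProjection_le F x F.zero_mem

/-- The bound passes to `A = |T| = U T`, which is therefore compact. In an eigenbasis the diagonal
entries of `A ^ p` are the `p`-th powers of those of `A`, so finite partial sums of the trace are at
most `C`. -/
theorem HasSchattenBound.isSchatten {p C : ℝ} (hp : 1 ≤ p) {T : H →L[ℂ] H}
    (h : HasSchattenBound p C T) : IsSchatten p T := by
  set A := CFC.abs T with hAdef
  have hA : 0 ≤ A := CFC.abs_nonneg T
  obtain ⟨U, hU, hAU⟩ := exists_contraction_comp_eq (F := A) (G := T)
    fun x => (norm_cfcAbs_apply T x).le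
  have hAC : HasSchattenBound p C A := hAU ▸ h.comp_left hU
  obtain ⟨ι, b, l, hl⟩ :=
    exists_hilbertBasis_eigenvectors hA (hAC.isCompactOperator (by linarith) hA)
  have hb (i : ι) : ⟪b i, b i⟫_ℂ = 1 := by
    rw [inner_self_eq_norm_sq_to_K, b.orthonormal.1 i]
    simp
  have hpow (i : ι) : RCLike.re ⟪(A ^ p) (b i), b i⟫_ℂ = ‖⟪A (b i), b i⟫_ℂ‖ ^ p := by
    rw [CFC.rpow_eq_cfc_real hA, cfc_apply_eigenvector (f := fun t => t ^ p) (.of_nonneg hA)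
      (b.orthonormal.ne_zero i) (hl i).2 (continuousOn_id.rpow_const fun _ _ => Or.inr (by linarith)),
      re_inner_real_smul_left, (hl i).2, ← Complex.coe_smul, inner_smul_left, hb]
    simp [abs_of_nonneg (hl i).1]
  have hAp : 0 ≤ A ^ p := CFC.rpow_nonneg
  have htr : trace (A ^ p) ≤ ENNReal.ofReal C := by
    rw [trace_eq_traceIn b hAp, traceIn, ENNReal.tsum_eq_iSup_sum]
    refine iSup_le fun s => ?_
    rw [← ENNReal.ofReal_sum_of_nonneg fun i _ => re_inner_nonneg hAp _]
    refine ENNReal.ofReal_le_ofReal ?_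
    have hx : IsBesselFamily fun i : s => b i :=
      (b.orthonormal.comp (fun i : s => (i : ι)) Subtype.val_injective).isBesselFamily
    have h1 := hAC.sum_le hx hx
    rw [Finset.sum_coe_sort s fun i => ‖⟪A (b i), b i⟫_ℂ‖ ^ p] at h1
    exact (Finset.sum_congr rfl fun i _ => hpow i).trans_le h1
  exact htr.trans_lt ENNReal.ofReal_lt_top

theorem isSchatten_iff_exists_hasSchattenBound {p : ℝ} (hp : 1 ≤ p) (T : H →L[ℂ] H) :
    IsSchatten p T ↔ ∃ C, HasSchattenBound p C T :=
  ⟨fun h => h.exists_hasSchattenBound hp, fun ⟨_, h⟩ => h.isSchatten hp⟩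

end SchattenConverse

/-! ### Equivalence relations -/

section Equivalences

variable {H : Type*} [NormedAddCommGroup H] [InnerProductSpace ℂ H]

theorem equivalence_modFinite : Equivalence (ModFinite (H := H)) where
  refl T := by
    rw [ModFinite, finiteDimensional_range_iff_exists_forall_not_linearIndependent]
    exact ⟨1, fun x hx => hx.ne_zero 0 (by simp)⟩
  symm {T S} h := by
    rw [ModFinite, finiteDimensional_range_iff_exists_forall_not_linearIndependent] at h ⊢
    obtain ⟨n, hn⟩ := h
    refine ⟨n, fun x hx => hn x ?_⟩
    simpa [Function.comp_def] using
      hx.map' (LinearEquiv.neg ℂ : H ≃ₗ[ℂ] H).toLinearMap (LinearEquiv.ker _)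
  trans {T S R} h h' := by
    have : FiniteDimensional ℂ (T - S).range := h
    have : FiniteDimensional ℂ (S - R).range := h'
    refine Submodule.finiteDimensional_of_le (S₂ := (T - S).range ⊔ (S - R).range) ?_
    rintro _ ⟨x, rfl⟩
    have : (T - R) x = (T - S) x + (S - R) x := by simp
    exact this ▸ Submodule.add_mem_sup ⟨x, rfl⟩ ⟨x, rfl⟩

theorem equivalence_modCompact : Equivalence (ModCompact (H := H)) where
  refl T := by
    rw [ModCompact, sub_self]
    exact isCompactOperator_zero
  symm {T S} h := by
    rw [ModCompact, ← neg_sub]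
    exact IsCompactOperator.neg h
  trans {T S R} h h' := by
    rw [ModCompact, ← sub_add_sub_cancel T S R]
    exact IsCompactOperator.add h h'

theorem equivalence_modSchatten [CompleteSpace H] {p : ℝ} (hp : 1 ≤ p) :
    Equivalence (ModSchatten (H := H) p) where
  refl T := by
    rw [ModSchatten, sub_self, isSchatten_iff_exists_hasSchattenBound hp]
    exact ⟨0, hasSchattenBound_zero (by linarith)⟩
  symm {T S} h := by
    rw [ModSchatten, isSchatten_iff_exists_hasSchattenBound hp] at h ⊢
    obtain ⟨C, hC⟩ := h
    exact ⟨C, by simpa using hC.neg⟩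
  trans {T S R} h h' := by
    rw [ModSchatten, isSchatten_iff_exists_hasSchattenBound hp] at h h' ⊢
    obtain ⟨C, hC⟩ := h
    obtain ⟨D, hD⟩ := h'
    exact ⟨_, by simpa using hC.add (by linarith) hD⟩

end Equivalences

/-! ### Borel equivalence relations from measurable evaluations -/

section Pullback

variable {H : Type*} [NormedAddCommGroup H] [InnerProductSpace ℂ H]
  [CompleteSpace H] [SeparableSpace H] [MeasurableSpace H] [BorelSpace H]
  {X : Type*} [MeasurableSpace X] {c : X → H →L[ℂ] H}

/-- Only measurability of the evaluations on `X` enters, so this form serves all three spaces and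
gives measurability directly in the product σ-algebra. -/
theorem isBorelEquivalence_modFinite_pullback (hc : ∀ x, Measurable fun T => c T x) :
    IsBorelEquivalence fun T S => ModFinite (c T) (c S) where
  equivalence := equivalence_modFinite.comap c
  measurableSet_relGraph := measurableSet_setOf_finiteDimensional_range fun x =>
    ((hc x).comp measurable_fst).sub ((hc x).comp measurable_snd)

theorem isBorelEquivalence_modCompact_pullback (hc : ∀ x, Measurable fun T => c T x) :
    IsBorelEquivalence fun T S => ModCompact (c T) (c S) where
  equivalence := equivalence_modCompact.comap c
  measurableSet_relGraph := measurableSet_setOf_isCompactOperator fun x =>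
    ((hc x).comp measurable_fst).sub ((hc x).comp measurable_snd)

theorem isBorelEquivalence_modSchatten_pullback (hc : ∀ x, Measurable fun T => c T x)
    {p : ℝ} (hp : 1 ≤ p) : IsBorelEquivalence fun T S => ModSchatten p (c T) (c S) where
  equivalence := (equivalence_modSchatten hp).comap c
  measurableSet_relGraph := by
    have := measurableSet_setOf_exists_hasSchattenBound (p := p)
      (f := fun q : X × X => c q.1 - c q.2) (fun x =>
      ((hc x).comp measurable_fst).sub ((hc x).comp measurable_snd)) (by linarith)
    simp only [← isSchatten_iff_exists_hasSchattenBound hp] at this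
    exact this

end Pullback

end OperatorRelations

theorem mainTheorem8 (H : Type*) [NormedAddCommGroup H] [InnerProductSpace ℂ H] [CompleteSpace H]
    [TopologicalSpace.SeparableSpace H] (hH : ¬ FiniteDimensional ℂ H) :
    -- the spaces: `B(H)` is standard Borel, the unit ball and the compact operators are Polish
    (StandardBorelSpace (StrongOp H) ∧ PolishSpace (StrongBall H) ∧ PolishSpace (CompactOp H)) ∧
    -- the relations are Borel on `B(H)`
    (IsBorelEquivalence (onStrong (ModFinite (H := H))) ∧
      IsBorelEquivalence (onStrong (ModCompact (H := H))) ∧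
      ∀ p : ℝ, 1 ≤ p → IsBorelEquivalence (onStrong (ModSchatten (H := H) p))) ∧
    -- the relations are Borel on the unit ball
    (IsBorelEquivalence (onBall (ModFinite (H := H))) ∧
      IsBorelEquivalence (onBall (ModCompact (H := H))) ∧
      ∀ p : ℝ, 1 ≤ p → IsBorelEquivalence (onBall (ModSchatten (H := H) p))) ∧
    -- the relations are Borel on the compact operators
    (IsBorelEquivalence (onCompact (ModFinite (H := H))) ∧
      IsBorelEquivalence (onCompact (ModCompact (H := H))) ∧
      ∀ p : ℝ, 1 ≤ p → IsBorelEquivalence (onCompact (ModSchatten (H := H) p))) ∧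
    -- the complexity on the two Polish spaces
    (IsFSigma (relGraph (onBall (ModFinite (H := H)))) ∧
      IsFSigmaDelta (relGraph (onBall (ModCompact (H := H))))) ∧
    (IsFSigma (relGraph (onCompact (ModFinite (H := H)))) ∧
      IsFSigmaDelta (relGraph (onCompact (ModCompact (H := H))))) := by
  borelize H
  have evalStrong (x : H) : Continuous fun T : StrongOp H => T.toCLM x := continuous_eval_const x
  have evalBall (x : H) : Continuous fun T : StrongBall H => T.1.toCLM x :=
    (evalStrong x).comp continuous_subtype_val
  have evalCompact (x : H) : Continuous fun T : CompactOp H => (T.1 : H →L[ℂ] H) x :=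
    (ContinuousLinearMap.apply ℂ H x).continuous.comp continuous_subtype_val
  have diffBall (x : H) : Continuous fun q : StrongBall H × StrongBall H =>
      (q.1.1.toCLM - q.2.1.toCLM) x :=
    ((evalBall x).comp continuous_fst).sub ((evalBall x).comp continuous_snd)
  have diffCompact (x : H) : Continuous fun q : CompactOp H × CompactOp H =>
      (q.1.1 - q.2.1 : H →L[ℂ] H) x :=
    ((evalCompact x).comp continuous_fst).sub ((evalCompact x).comp continuous_snd)
  have mStrong := fun x => (evalStrong x).measurable
  have mBall := fun x => (evalBall x).measurable
  have mCompact := fun x => (evalCompact x).measurable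
  exact ⟨⟨standardBorelSpace_strongOp, polishSpace_strongBall, polishSpace_compactOp⟩,
    ⟨isBorelEquivalence_modFinite_pullback mStrong, isBorelEquivalence_modCompact_pullback mStrong,
      fun _ hp => isBorelEquivalence_modSchatten_pullback mStrong hp⟩,
    ⟨isBorelEquivalence_modFinite_pullback mBall, isBorelEquivalence_modCompact_pullback mBall,
      fun _ hp => isBorelEquivalence_modSchatten_pullback mBall hp⟩,
    ⟨isBorelEquivalence_modFinite_pullback mCompact,
      isBorelEquivalence_modCompact_pullback mCompact,
      fun _ hp => isBorelEquivalence_modSchatten_pullback mCompact hp⟩,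
    ⟨isFSigma_setOf_finiteDimensional_range diffBall,
      isFSigmaDelta_setOf_isCompactOperator diffBall⟩,
    isFSigma_setOf_finiteDimensional_range diffCompact,
    isFSigmaDelta_setOf_isCompactOperator diffCompact⟩
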